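/- **Setting.** Let $\Bbbk$ be a field, $K$ a finite abstract simplicial complex and $p\ge 0$ an integer. A *filter function* is a function $f:K\to\mathbb{R}$ with $f(\sigma)\le f(\sigma')$ whenever $\sigma\subseteq\sigma'$; its degree-$p$ persistence module is $t\mapsto H_p(\{\sigma\in K: f(\sigma)\le t\};\Bbbk)$ with the maps induced by inclusions. If this module is isomorphic to a finite direct sum of interval modules on intervals $J_1,\dots,J_N$, its persistence diagram $\mathrm{Dgm}_p(f)$ is the multiset of the points $(\inf J_i,\sup J_i)\in\mathbb{R}\times(\mathbb{R}\cup\{+\infty\})$ together with countably many copies of every point of the diagonal (this multiset is denoted $\Delta^\infty$). $Bar$ is the set of all multisets $D\cup\Delta^\infty$ with $D$ a finite multiset in $\mathbb{R}\times(\mathbb{R}\cup\{+\infty\})$, and $Q_{m,n}:\mathbb{R}^{2m}\times\mathbb{R}^n\to Bar$ is $Q_{m,n}(b_1,d_1,\dots,b_m,d_m,v_1,\dots,v_n)=\{(b_i,d_i)\}_{i}\cup\{(v_j,+\infty)\}_{j}\cup\Delta^\infty$. Two functions on $K$ are *ordering equivalent* if they induce the same pre-order on $K$; $\Omega(\mathbb{R}^K)$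 is the partition of $\mathbb{R}^K$ into ordering equivalence classes. Let $\mathcal{M}$ be a smooth $d$-dimensional manifold without boundary. A *Whitney stratification* of $\mathcal{M}$ is a locally finite partition $\mathcal{S}$ of $\mathcal{M}$ into connected smooth (embedded, not necessarily closed) submanifolds, called strata, such that $\overline{S}\setminus S$ is a union of strata for every stratum $S$, and Whitney's condition (b) holds: if $S,S'$ are strata, $\theta\in S$, and $\theta'_k\in S$, $\theta''_k\in S'$ converge to $\theta$ in such a way that, in local coordinates around $\theta$, the lines $(\theta'_k\theta''_k)$ converge to a line $l$ and the tangent spaces $T_{\theta''_k}S'$ converge to a flat, then this flat contains $l$. A stratum $S$ is *incident* to $\theta\in\mathcal{M}$ if $\theta\in\overline{S}$. A map $B:\mathcal{M}\to Bar$ is *$r$-differentiable at $\theta$* if there are an open neighborhood $U$ of $\theta$, integers $m,n\ge0$ and a $C^r$ map $\tilde B:U\to\mathbb{R}^{2m}\times\mathbb{R}^n$ with $B=Q_{m,n}\circ\tilde B$ on $U$. It is *$r$-differentiable at $\theta$ along* a stratum $S$ incident to $\theta$ if there are such $U,m,n$ and a $C^r$ map $\tilde B:U\to\mathbb{R}^{2m}\times\mathbb{R}^n$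 with $B=Q_{m,n}\circ\tilde B$ on $U\cap S$; for $r\ge1$ the differential $d_\theta\tilde B$ is then called a *directional derivative* of $B$ at $\theta$ along $S$. **Theorem (Discrete smoothness along strata).** Let $r\in\mathbb{N}$ and let $F:\mathcal{M}\to\mathbb{R}^K$ be a map all of whose values are filter functions. Suppose that $\mathcal{S}$ is a Whitney stratification of $\mathcal{M}$ such that: (i) $F$ is weakly stratified with respect to $\mathcal{S}$ and $\Omega(\mathbb{R}^K)$, i.e. the preimage under $F$ of every ordering equivalence class is a union of strata of $\mathcal{S}$; (ii) the restriction of $F$ to each stratum of $\mathcal{S}$ is $C^r$; (iii) for every $\theta\in\mathcal{M}$ and every stratum $S\in\mathcal{S}$ incident to $\theta$, there is an open neighborhood $U$ of $\theta$ in $\mathcal{M}$ such that $F|_{S\cap U}$ extends to a $C^r$ map $U\to\mathbb{R}^K$. Then, at every $\theta\in\mathcal{M}$, the map $B_p:\mathcal{M}\to Bar$, $B_p(\theta)=\mathrm{Dgm}_p(F(\theta))$, is $r$-differentiable along each stratum incident to $\theta$; in particular, if $r\ge1$, it has a directional derivative at $\theta$ along each such stratum. Moreover, $B_p$ is $r$-differentiable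 at every point of every top-dimensional (i.e. $d$-dimensional) stratum. -/

import Mathlib

open Set Filter Topology CategoryTheory
open scoped Manifold ContDiff

noncomputable section

namespace DiscreteSmoothness

universe u v

/-! ### Persistence modules and interval decompositions -/

section PersistenceModules

variable (k : Type u) [Field k]

/-- A persistence module over `k`: a functor from the poset `(ℝ, ≤)` to `k`-vector spaces. -/
abbrev PersistenceModule : Type (max (u + 1) (v + 1)) := ℝ ⥤ ModuleCat.{max u v} k

/-- The space at time `t` of the interval module on `J`: a copy of `k` if `t ∈ J`, zero if not. -/
def intervalSpace (J : Set ℝ) (t : ℝ) : Submodule k (ULift.{v} k) where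
  carrier := {x | t ∉ J → x = 0}
  add_mem' := fun {a b} ha hb ht => by rw [ha ht, hb ht, add_zero]
  zero_mem' := fun _ => rfl
  smul_mem' := fun c x hx ht => by rw [hx ht, smul_zero]

open Classical in
/-- The structure map of the interval module on `J`: the identity of `k` if both times are
in `J`, zero otherwise. -/
def intervalMap (J : Set ℝ) (s t : ℝ) :
    intervalSpace.{u, v} k J s →ₗ[k] intervalSpace.{u, v} k J t where
  toFun x := ⟨if t ∈ J then x.1 else 0, fun ht => by simp [ht]⟩
  map_add' x y := by
    apply Subtype.ext
    by_cases ht : t ∈ J <;> simp [ht]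
  map_smul' c x := by
    apply Subtype.ext
    by_cases ht : t ∈ J <;> simp [ht]

open Classical in
/-- The interval module on an interval `J` of `ℝ`. -/
def intervalModule (J : Set ℝ) (hJ : J.OrdConnected) : PersistenceModule.{u, v} k where
  obj t := ModuleCat.of k (intervalSpace.{u, v} k J t)
  map {s t} _ := ModuleCat.ofHom (intervalMap.{u, v} k J s t)
  map_id t := by
    refine ModuleCat.hom_ext (LinearMap.ext fun x => Subtype.ext ?_)
    change (if t ∈ J then x.1 else 0) = x.1
    split_ifs with ht
    · rfl
    · exact (x.2 ht).symm
  map_comp {r s t} f g := by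
    refine ModuleCat.hom_ext (LinearMap.ext fun x => Subtype.ext ?_)
    change (if t ∈ J then x.1 else 0) = if t ∈ J then (if s ∈ J then x.1 else 0) else 0
    split_ifs with ht hs
    · rfl
    · exact x.2 fun hr => hs (hJ.out hr ht ⟨leOfHom f, leOfHom g⟩)
    · rfl

variable {k}

/-- The (pointwise) direct sum of a family of persistence modules. -/
def directSum {ι : Type} (W : ι → PersistenceModule.{u, v} k) : PersistenceModule.{u, v} k where
  obj t := ModuleCat.of k (DirectSum ι fun i => (W i).obj t)
  map f := ModuleCat.ofHom (DirectSum.lmap fun i => ((W i).map f).hom)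
  map_id t := by
    ext x : 2
    refine DFinsupp.ext fun i => ?_
    simp
  map_comp f g := by
    ext x : 2
    refine DFinsupp.ext fun i => ?_
    simp

end PersistenceModules

/-! ### Persistence diagrams -/

/-- The multiset `B ∪ Δ^∞`, given by its multiplicities: the finite multiset `B` of points of
`ℝ × (ℝ ∪ {+∞})` together with countably many copies of every point of the diagonal. -/
def withDiagonal (B : Multiset (ℝ × WithTop ℝ)) (x : ℝ × WithTop ℝ) : ℕ∞ :=
  open Classical in
  (B.count x : ℕ∞) + (if x.2 = (x.1 : WithTop ℝ) then ⊤ else 0)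

/-- The set of persistence diagrams (barcodes). -/
def Bar : Type := {D : ℝ × WithTop ℝ → ℕ∞ // ∃ B : Multiset (ℝ × WithTop ℝ), D = withDiagonal B}

/-- The persistence diagram `B ∪ Δ^∞`. -/
def Bar.ofMultiset (B : Multiset (ℝ × WithTop ℝ)) : Bar := ⟨withDiagonal B, B, rfl⟩

open Classical in
/-- The point `(inf J, sup J)` of a nonempty interval `J` that is bounded below. -/
def endpoints (J : Set ℝ) : ℝ × WithTop ℝ :=
  (sInf J, if BddAbove J then ((sSup J : ℝ) : WithTop ℝ) else ⊤)

/-- `D` is a persistence diagram of the persistence module `W`: `W` is isomorphic to a finite direct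
sum of interval modules, and `D` consists of the points `(inf J, sup J)` of these intervals and of
the diagonal.  The intervals are bounded below because diagrams live in `ℝ × (ℝ ∪ {+∞})`; this is
automatic for the sublevel set persistence of a function on a finite complex. -/
def IsDiagramOf {k : Type u} [Field k] (W : PersistenceModule.{u, v} k) (D : Bar) : Prop :=
  ∃ (N : ℕ) (J : Fin N → Set ℝ) (hJ : ∀ i, (J i).OrdConnected),
    (∀ i, (J i).Nonempty ∧ BddBelow (J i)) ∧
    Nonempty (W ≅ directSum fun i => intervalModule.{u, v} k (J i) (hJ i)) ∧
    D = Bar.ofMultiset (Finset.univ.val.map fun i => endpoints (J i))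

open Classical in
/-- The persistence diagram of a persistence module of finite type, i.e. the one given by an
interval decomposition (by the uniqueness of interval decompositions it does not depend on the
choice).  The value on modules that are not of finite type is irrelevant. -/
def diagram {k : Type u} [Field k] (W : PersistenceModule.{u, v} k) : Bar :=
  if h : ∃ D, IsDiagramOf W D then h.choose else Bar.ofMultiset 0

/-! ### Simplicial homology and the persistence diagram of a filter function -/

section Subquotients

variable {k : Type u} [Field k] {X : Type v} [AddCommGroup X] [Module k X]

/-- The quotient `Z / (B ∩ Z)` of subspaces of a vector space (`Z / B` if `B ⊆ Z`). -/
abbrev Subquotient (Z B : Submodule k X) : Type v := Z ⧸ B.submoduleOf Z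

/-- The map `Z / B → Z' / B'` induced by inclusions `Z ⊆ Z'` and `B ⊆ B'`. -/
def subquotientMap {Z B Z' B' : Submodule k X} (hZ : Z ≤ Z') (hB : B ≤ B') :
    Subquotient Z B →ₗ[k] Subquotient Z' B' :=
  Submodule.mapQ _ _ (Submodule.inclusion hZ) fun _ hx => hB hx

end Subquotients

section Homology

variable {V : Type v}

/-- The filter functions on a simplicial complex `K`: the functions `K → ℝ` that are monotone with
respect to inclusion of faces. -/
def FilterFunction (K : PreAbstractSimplicialComplex V) : Type v := {f : K → ℝ // Monotone f}

/-- The sublevel complex `K^t = {σ ∈ K | f σ ≤ t}` of a filter function. -/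
def FilterFunction.sublevel {K : PreAbstractSimplicialComplex V} (f : FilterFunction K) (t : ℝ) :
    PreAbstractSimplicialComplex V where
  faces := {σ | ∃ h : σ ∈ K, f.1 ⟨σ, h⟩ ≤ t}
  isRelLowerSet_faces := by
    rintro σ ⟨hσ, hσt⟩
    refine ⟨(K.isRelLowerSet_faces hσ).1, fun τ hτσ hτ => ?_⟩
    have hτK : τ ∈ K := (K.isRelLowerSet_faces hσ).2 hτσ hτ
    have hle : (⟨τ, hτK⟩ : K) ≤ ⟨σ, hσ⟩ := hτσ
    exact ⟨hτK, (f.2 hle).trans hσt⟩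

lemma FilterFunction.sublevel_mono {K : PreAbstractSimplicialComplex V} (f : FilterFunction K)
    {s t : ℝ} (h : s ≤ t) : f.sublevel s ≤ f.sublevel t :=
  fun _ ⟨hσ, hs⟩ => ⟨hσ, hs.trans h⟩

variable (k : Type u) [Field k]

/-- The `p`-chains of the complex `L`: formal `k`-linear combinations of its `p`-dimensional
simplices, i.e. of its faces with `p + 1` vertices. -/
def chains (L : PreAbstractSimplicialComplex V) (p : ℕ) : Submodule k (Finset V →₀ k) :=
  Finsupp.supported k k {σ | σ ∈ L ∧ σ.card = p + 1}

lemma chains_mono {L L' : PreAbstractSimplicialComplex V} (h : L ≤ L') (p : ℕ) :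
    chains k L p ≤ chains k L' p :=
  Finsupp.supported_mono fun _ hσ => ⟨h hσ.1, hσ.2⟩

variable [LinearOrder V]

/-- The simplicial boundary operator, every simplex being oriented by the order of its vertices:
`∂[v₀ < ⋯ < v_p] = ∑ i, (-1)^i [v₀, …, v̂ᵢ, …, v_p]` for `p ≥ 1`, and `∂[v₀] = 0`. -/
def boundary : (Finset V →₀ k) →ₗ[k] (Finset V →₀ k) :=
  Finsupp.linearCombination k fun σ : Finset V =>
    ∑ v ∈ σ with (σ.erase v).Nonempty,
      ((-1 : k) ^ (σ.filter (· < v)).card) • Finsupp.single (σ.erase v) (1 : k)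

/-- The `p`-cycles of `L`. -/
def cycles (L : PreAbstractSimplicialComplex V) (p : ℕ) : Submodule k (Finset V →₀ k) :=
  chains k L p ⊓ LinearMap.ker (boundary k)

/-- The `p`-boundaries of `L`. -/
def boundaries (L : PreAbstractSimplicialComplex V) (p : ℕ) : Submodule k (Finset V →₀ k) :=
  (chains k L (p + 1)).map (boundary k)

lemma cycles_mono {L L' : PreAbstractSimplicialComplex V} (h : L ≤ L') (p : ℕ) :
    cycles k L p ≤ cycles k L' p :=
  inf_le_inf_right _ (chains_mono k h p)

lemma boundaries_mono {L L' : PreAbstractSimplicialComplex V} (h : L ≤ L') (p : ℕ) :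
    boundaries k L p ≤ boundaries k L' p :=
  Submodule.map_mono (chains_mono k h (p + 1))

/-- Simplicial homology `H_p(L) = Z_p(L) / B_p(L)` with coefficients in `k`. -/
abbrev Homology (L : PreAbstractSimplicialComplex V) (p : ℕ) : Type (max u v) :=
  Subquotient (cycles k L p) (boundaries k L p)

/-- The map `H_p(L) → H_p(L')` induced by an inclusion `L ⊆ L'`. -/
def homologyMap {L L' : PreAbstractSimplicialComplex V} (h : L ≤ L') (p : ℕ) :
    Homology k L p →ₗ[k] Homology k L' p :=
  subquotientMap (cycles_mono k h p) (boundaries_mono k h p)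

variable {K : PreAbstractSimplicialComplex V}

/-- The sublevel set persistent homology of a filter function in degree `p`. -/
def persistentHomology (f : FilterFunction K) (p : ℕ) : PersistenceModule.{u, v} k where
  obj t := ModuleCat.of k (Homology k (f.sublevel t) p)
  map {s t} h := ModuleCat.ofHom (homologyMap k (f.sublevel_mono (leOfHom h)) p)
  map_id t := by
    ext x
    rfl
  map_comp {r s t} g h := by
    ext x
    rfl

/-- `Dgm_p(f)`: the degree-`p` persistence diagram of a filter function. -/
def Dgm (p : ℕ) (f : FilterFunction K) : Bar := diagram (persistentHomology k f p)

end Homology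

/-! ### Ordering equivalence -/

/-- Two functions `K → ℝ` are ordering equivalent if they induce the same pre-order on `K`. -/
def orderingSetoid (K : Type v) : Setoid (K → ℝ) where
  r f g := ∀ σ τ : K, f σ ≤ f τ ↔ g σ ≤ g τ
  iseqv := ⟨fun _ _ _ => Iff.rfl, fun h σ τ => (h σ τ).symm,
    fun h h' σ τ => (h σ τ).trans (h' σ τ)⟩

/-- The stratification `Ω(ℝ^K)` of `ℝ^K` by ordering equivalence classes. -/
def orderingClasses (K : Type v) : Set (Set (K → ℝ)) := (orderingSetoid K).classes

/-! ### Whitney stratifications -/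

section Stratifications

variable {d : ℕ} {M : Type*} [TopologicalSpace M] [ChartedSpace (EuclideanSpace ℝ (Fin d)) M]

/-- `φ` is a smooth chart of `M` in which `S` is the linear subspace `W` of `ℝ^d`. -/
def IsSliceChart (φ : OpenPartialHomeomorph M (EuclideanSpace ℝ (Fin d)))
    (W : Submodule ℝ (EuclideanSpace ℝ (Fin d))) (S : Set M) : Prop :=
  φ ∈ IsManifold.maximalAtlas (𝓡 d) ∞ M ∧ ∀ y ∈ φ.source, y ∈ S ↔ φ y ∈ W

/-- `S` is an (embedded, not necessarily closed) smooth submanifold of `M` of dimension `e`. -/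
def IsSubmanifold (e : ℕ) (S : Set M) : Prop :=
  ∀ x ∈ S, ∃ (φ : OpenPartialHomeomorph M (EuclideanSpace ℝ (Fin d)))
    (W : Submodule ℝ (EuclideanSpace ℝ (Fin d))),
    x ∈ φ.source ∧ IsSliceChart φ W S ∧ Module.finrank ℝ W = e

/-- The tangent space at `y` of the submanifold `S`, read in the chart `φ` as a linear subspace
of `ℝ^d`: the velocities at `y` of the curves in `S`. -/
def tangentFlat (φ : OpenPartialHomeomorph M (EuclideanSpace ℝ (Fin d))) (S : Set M) (y : M) :
    Submodule ℝ (EuclideanSpace ℝ (Fin d)) :=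
  Submodule.span ℝ {w | ∃ γ : ℝ → M, (∀ t, γ t ∈ S) ∧ γ 0 = y ∧ ContinuousAt γ 0 ∧
    HasDerivAt (fun t => φ (γ t)) w 0}

/-- Convergence of linear subspaces of `ℝ^d` (in the Grassmannians): convergence of the orthogonal
projections onto them. -/
def FlatTendsto (T : ℕ → Submodule ℝ (EuclideanSpace ℝ (Fin d)))
    (T' : Submodule ℝ (EuclideanSpace ℝ (Fin d))) : Prop :=
  Tendsto (fun n => (T n).starProjection) atTop (𝓝 T'.starProjection)

/-- Whitney's condition (b) for the pair of strata `(S, S')`: if `x' n ∈ S` and `x'' n ∈ S'` converge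
to `x ∈ S` in such a way that, in local coordinates `φ` around `x`, the secant lines through `x' n`
and `x'' n` converge to a line `l` and the tangent spaces of `S'` at `x'' n` converge to a flat `T`,
then `T` contains `l`.  Lines and flats are identified with their directions. -/
def WhitneyConditionB (S S' : Set M) : Prop :=
  ∀ x ∈ S, ∀ φ ∈ IsManifold.maximalAtlas (𝓡 d) ∞ M, x ∈ φ.source →
    ∀ x' x'' : ℕ → M, (∀ n, x' n ∈ S) → (∀ n, x'' n ∈ S') →
    Tendsto x' atTop (𝓝 x) → Tendsto x'' atTop (𝓝 x) →
    ∀ l T : Submodule ℝ (EuclideanSpace ℝ (Fin d)), Module.finrank ℝ l = 1 →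
    FlatTendsto (fun n => Submodule.span ℝ {φ (x'' n) - φ (x' n)}) l →
    FlatTendsto (fun n => tangentFlat φ S' (x'' n)) T →
    l ≤ T

/-- `𝒮` is a Whitney stratification of the `d`-dimensional smooth manifold `M`. -/
structure IsWhitneyStratification (d : ℕ) {M : Type*} [TopologicalSpace M]
    [ChartedSpace (EuclideanSpace ℝ (Fin d)) M] (𝒮 : Set (Set M)) : Prop where
  /-- strata are connected -/
  connected : ∀ S ∈ 𝒮, IsConnected S
  /-- strata are smooth submanifolds -/
  submanifold : ∀ S ∈ 𝒮, ∃ e, IsSubmanifold (d := d) e S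
  /-- the strata partition `M` -/
  partition : 𝒮.PairwiseDisjoint id ∧ ⋃₀ 𝒮 = univ
  /-- each point has an open neighborhood meeting finitely many strata -/
  locally_finite : ∀ x : M, ∃ U : Set M, IsOpen U ∧ x ∈ U ∧ {S ∈ 𝒮 | (S ∩ U).Nonempty}.Finite
  /-- the frontier `closure S \ S` of a stratum is a union of strata -/
  frontier : ∀ S ∈ 𝒮, ∃ 𝒯 ⊆ 𝒮, closure S \ S = ⋃₀ 𝒯
  /-- Whitney's condition (b) -/
  condition_b : ∀ S ∈ 𝒮, ∀ S' ∈ 𝒮, WhitneyConditionB (d := d) S S'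

/-- A map between stratified spaces is weakly stratified if the preimage of every stratum is a union
of strata. -/
def IsWeaklyStratified {X Y : Type*} (f : X → Y) (𝒮 : Set (Set X)) (𝒯 : Set (Set Y)) : Prop :=
  ∀ T ∈ 𝒯, ∃ 𝒰 ⊆ 𝒮, f ⁻¹' T = ⋃₀ 𝒰

/-- The restriction of `F` to the submanifold `S` is of class `C^r`: around every point of `S` it is
so in the coordinates that a slice chart of `M` induces on `S`. -/
def ContDiffOnSubmanifold (d : ℕ) {M : Type*} [TopologicalSpace M]
    [ChartedSpace (EuclideanSpace ℝ (Fin d)) M] {E' : Type*} [NormedAddCommGroup E']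
    [NormedSpace ℝ E'] (r : ℕ) (F : M → E') (S : Set M) : Prop :=
  ∀ x ∈ S, ∃ (φ : OpenPartialHomeomorph M (EuclideanSpace ℝ (Fin d)))
    (W : Submodule ℝ (EuclideanSpace ℝ (Fin d))),
    x ∈ φ.source ∧ IsSliceChart φ W S ∧
    ContDiffOn ℝ r (fun w : W => F (φ.symm w)) {w : W | (w : EuclideanSpace ℝ (Fin d)) ∈ φ.target}

end Stratifications

/-! ### Differentiability of barcode valued maps -/

/-- The ordered barcodes `ℝ^{2m} × ℝ^n` with `m` finite and `n` infinite bars. -/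
abbrev OrderedBarcode (m n : ℕ) : Type := (Fin m → ℝ × ℝ) × (Fin n → ℝ)

/-- The quotient map `Q_{m,n} : ℝ^{2m} × ℝ^n → Bar`, which forgets the order of the bars. -/
def Q (m n : ℕ) (b : OrderedBarcode m n) : Bar :=
  Bar.ofMultiset
    (Finset.univ.val.map (fun i : Fin m => ((b.1 i).1, ((b.1 i).2 : WithTop ℝ))) +
      Finset.univ.val.map (fun j : Fin n => (b.2 j, (⊤ : WithTop ℝ))))

section Differentiability

variable (d : ℕ) {M : Type*} [TopologicalSpace M] [ChartedSpace (EuclideanSpace ℝ (Fin d)) M]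

/-- The barcode valued map `B` is `r`-differentiable at `x`: it has a local lift of class `C^r`. -/
def RDifferentiableAt (r : ℕ) (B : M → Bar) (x : M) : Prop :=
  ∃ U : Set M, IsOpen U ∧ x ∈ U ∧ ∃ (m n : ℕ) (B' : M → OrderedBarcode m n),
    ContMDiffOn (𝓡 d) 𝓘(ℝ, OrderedBarcode m n) r B' U ∧ ∀ y ∈ U, B y = Q m n (B' y)

/-- `B'` is, on the open neighborhood `U` of `x`, a map of class `C^r` to ordered barcodes that
lifts the restriction of `B` to `U ∩ S`. -/
structure IsLiftAlong (r : ℕ) (B : M → Bar) (S : Set M) (x : M) (U : Set M) {m n : ℕ}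
    (B' : M → OrderedBarcode m n) : Prop where
  isOpen : IsOpen U
  mem : x ∈ U
  contMDiffOn : ContMDiffOn (𝓡 d) 𝓘(ℝ, OrderedBarcode m n) r B' U
  lifts : ∀ y ∈ U ∩ S, B y = Q m n (B' y)

/-- The barcode valued map `B` is `r`-differentiable at `x` along the stratum `S`. -/
def RDifferentiableAlong (r : ℕ) (B : M → Bar) (S : Set M) (x : M) : Prop :=
  ∃ (U : Set M) (m n : ℕ) (B' : M → OrderedBarcode m n), IsLiftAlong d r B S x U B'

/-- The linear map `D` is a directional derivative of `B` at `x` along the stratum `S`: the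
differential at `x` of a local lift of class `C^r` along `S`. -/
def IsDirectionalDerivative (r : ℕ) (B : M → Bar) (S : Set M) (x : M) {m n : ℕ}
    (D : TangentSpace (𝓡 d) x →L[ℝ] OrderedBarcode m n) : Prop :=
  ∃ (U : Set M) (B' : M → OrderedBarcode m n), IsLiftAlong d r B S x U B' ∧
    HasMFDerivAt (𝓡 d) 𝓘(ℝ, OrderedBarcode m n) B' x D

end Differentiability

end DiscreteSmoothness

end

open Set
open scoped Manifold ContDiff
open DiscreteSmoothness

namespace DiscreteSmoothness

universe u v

/-! ### Linear algebra: a basis adapted to two chains of subspaces. -/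

section AdaptedBasis

variable {k : Type*} [Field k] {X : Type*} [AddCommGroup X] [Module k X]

open Module Submodule

/-- A nonempty set of subspaces of a finite-dimensional space `H` that is a chain has a greatest
element. -/
lemma exists_greatest_of_chain {ι : Type*} [Nonempty ι] (Z : ι → Submodule k X)
    (hZ : ∀ i j, Z i ≤ Z j ∨ Z j ≤ Z i) (H : Submodule k X) [FiniteDimensional k H]
    (hH : ∀ i, Z i ≤ H) : ∃ i, ∀ j, Z j ≤ Z i := by
  have hfin : (range fun i => finrank k (Z i)).Finite :=
    (Set.finite_Iic (finrank k H)).subset (by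
      rintro _ ⟨i, rfl⟩
      exact Submodule.finrank_mono (hH i))
  obtain ⟨_, ⟨i, rfl⟩, hi⟩ := Set.exists_max_image _ id hfin (range_nonempty _)
  refine ⟨i, fun j => (hZ i j).elim (fun h => ?_) id⟩
  have : FiniteDimensional k (Z j) := Submodule.finiteDimensional_of_le (hH j)
  exact (Submodule.eq_of_le_of_finrank_le h (hi _ ⟨j, rfl⟩)).ge

/-- A nonempty chain of subspaces of a finite-dimensional space has a least element. -/
lemma exists_least_of_chain {ι : Type*} [Nonempty ι] (Z : ι → Submodule k X)
    (hZ : ∀ i j, Z i ≤ Z j ∨ Z j ≤ Z i) (H : Submodule k X) [FiniteDimensional k H]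
    (hH : ∀ i, Z i ≤ H) : ∃ i, ∀ j, Z i ≤ Z j := by
  obtain ⟨_, ⟨i, rfl⟩, hi⟩ := WellFounded.has_min (wellFounded_lt (α := ℕ))
    (range fun i => finrank k (Z i)) (range_nonempty _)
  refine ⟨i, fun j => (hZ i j).elim id (fun h => ?_)⟩
  have : FiniteDimensional k (Z i) := Submodule.finiteDimensional_of_le (hH i)
  exact (Submodule.eq_of_le_of_finrank_le h (not_lt.1 (hi _ ⟨j, rfl⟩))).ge

/-- Two chains of subspaces of a nonzero finite-dimensional space are split simultaneously by some
hyperplane and some line complementary to it. -/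
lemma exists_splitting_hyperplane {ι ι' : Type*} (Z : ι → Submodule k X) (Z' : ι' → Submodule k X)
    (hZ : ∀ i j, Z i ≤ Z j ∨ Z j ≤ Z i) (hZ' : ∀ i j, Z' i ≤ Z' j ∨ Z' j ≤ Z' i)
    (H : Submodule k X) [FiniteDimensional k H] (hH : H ≠ ⊥) :
    ∃ (f : X →ₗ[k] k) (e : X), e ∈ H ∧ f e ≠ 0 ∧ (∀ i, e ∈ Z i ∨ Z i ⊓ H ≤ LinearMap.ker f) ∧
      ∀ i, e ∈ Z' i ∨ Z' i ⊓ H ≤ LinearMap.ker f := by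
  -- Adjoining `⊥` makes the family nonempty. If `f` kills the largest proper trace on `H`, each `Z
  -- i` either contains `H` or has its trace in the kernel; hence the first chain allows any `e` in
  -- `H`, which leaves `e` free for the second.
  let Y : Option {i // Z i ⊓ H < H} → Submodule k X := fun o => o.elim ⊥ fun i => Z i.1 ⊓ H
  have hY : ∀ i j, Y i ≤ Y j ∨ Y j ≤ Y i := by
    rintro (_ | i) (_ | j)
    · exact .inl le_rfl
    · exact .inl bot_le
    · exact .inr bot_le
    · exact (hZ i.1 j.1).imp (inf_le_inf_right H) (inf_le_inf_right H)
  have hYH : ∀ i, Y i < H := by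
    rintro (_ | i)
    · exact bot_lt_iff_ne_bot.2 hH
    · exact i.2
  obtain ⟨o, ho⟩ := exists_greatest_of_chain Y hY H fun i => (hYH i).le
  obtain ⟨x, hxH, hxY⟩ := SetLike.exists_of_lt (hYH o)
  obtain ⟨f, hfx, hf⟩ := Submodule.exists_le_ker_of_notMem hxY
  have key : ∀ e ∈ H, ∀ i, e ∈ Z i ∨ Z i ⊓ H ≤ LinearMap.ker f := fun e he i => by
    rcases (inf_le_right : Z i ⊓ H ≤ H).eq_or_lt with h | h
    · exact .inl ((inf_eq_right.1 h) he)
    · exact .inr ((ho (some ⟨i, h⟩)).trans hf)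
  by_cases hne : Nonempty {i // ¬ Z' i ⊓ H ≤ LinearMap.ker f}
  -- A vector of the least trace not killed by `f` lies in every `Z' j` whose trace is not killed.
  · obtain ⟨i, hi⟩ := exists_least_of_chain
      (fun i : {i // ¬ Z' i ⊓ H ≤ LinearMap.ker f} => Z' i.1 ⊓ H)
      (fun i j => (hZ' i.1 j.1).imp (inf_le_inf_right H) (inf_le_inf_right H)) H
      fun i => inf_le_right
    obtain ⟨e, he, hfe⟩ := SetLike.not_le_iff_exists.1 i.2
    refine ⟨f, e, he.2, hfe, key e he.2, fun j => ?_⟩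
    by_cases hj : Z' j ⊓ H ≤ LinearMap.ker f
    · exact .inr hj
    · exact .inl (hi ⟨j, hj⟩ he).1
  · exact ⟨f, x, hxH, hfx, key x hxH, fun j => .inr (by_contra fun hj => hne ⟨⟨j, hj⟩⟩)⟩

/-- Two chains of subspaces of a finite-dimensional space have a common adapted basis. -/
theorem exists_adapted_basis {ι ι' : Type*} (Z : ι → Submodule k X) (Z' : ι' → Submodule k X)
    (hZ : ∀ i j, Z i ≤ Z j ∨ Z j ≤ Z i) (hZ' : ∀ i j, Z' i ≤ Z' j ∨ Z' j ≤ Z' i)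
    (H : Submodule k X) [FiniteDimensional k H] :
    ∃ (n : ℕ) (e : Fin n → X), LinearIndependent k e ∧ (∀ j, e j ∈ H) ∧
      (∀ i, Z i ⊓ H ≤ span k (e '' {j | e j ∈ Z i})) ∧
      ∀ i, Z' i ⊓ H ≤ span k (e '' {j | e j ∈ Z' i}) := by
  induction hn : finrank k H using Nat.strong_induction_on generalizing H with
  | _ n ih =>
  by_cases hH : H = ⊥
  · subst hH
    exact ⟨0, Fin.elim0, linearIndependent_empty_type, fun j => j.elim0, by simp, by simp⟩
  obtain ⟨f, e₀, he₀, hfe₀, hs, hs'⟩ := exists_splitting_hyperplane Z Z' hZ hZ' H hH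
  have hlt : H ⊓ LinearMap.ker f < H :=
    inf_le_left.lt_of_ne fun h => hfe₀ (inf_eq_left.1 h he₀)
  have : FiniteDimensional k ↥(H ⊓ LinearMap.ker f) := Submodule.finiteDimensional_of_le hlt.le
  obtain ⟨N, e, he, heH, h1, h2⟩ :=
    ih _ (hn ▸ Submodule.finrank_lt_finrank_of_lt hlt) (H ⊓ LinearMap.ker f) rfl
  -- If `e₀ ∈ Y`, subtracting a multiple of `e₀` moves a vector of `Y ⊓ H` into the hyperplane;
  -- otherwise `Y ⊓ H` already lies there.
  have key : ∀ Y : Submodule k X, (e₀ ∈ Y ∨ Y ⊓ H ≤ LinearMap.ker f) →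
      Y ⊓ (H ⊓ LinearMap.ker f) ≤ span k (e '' {j | e j ∈ Y}) →
      Y ⊓ H ≤ span k ((Fin.cons e₀ e : Fin (N + 1) → X) ''
        {j | (Fin.cons e₀ e : Fin (N + 1) → X) j ∈ Y}) := by
    rintro Y h hY z ⟨hzY, hzH⟩
    have hsub : span k (e '' {j | e j ∈ Y}) ≤ span k ((Fin.cons e₀ e : Fin (N + 1) → X) ''
        {j | (Fin.cons e₀ e : Fin (N + 1) → X) j ∈ Y}) := by
      refine span_mono ?_
      rintro _ ⟨j, hj, rfl⟩
      exact ⟨j.succ, by simpa using hj, by simp⟩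
    rcases h with h | h
    · have hz : z - (f z / f e₀) • e₀ ∈ span k (e '' {j | e j ∈ Y}) :=
        hY ⟨Y.sub_mem hzY (Y.smul_mem _ h), H.sub_mem hzH (H.smul_mem _ he₀), by
          simp [hfe₀]⟩
      have he : e₀ ∈ span k ((Fin.cons e₀ e : Fin (N + 1) → X) ''
          {j | (Fin.cons e₀ e : Fin (N + 1) → X) j ∈ Y}) :=
        subset_span ⟨0, by simpa using h, by simp⟩
      simpa using add_mem (hsub hz) (smul_mem _ (f z / f e₀) he)
    · exact hsub (hY ⟨hzY, hzH, h ⟨hzY, hzH⟩⟩)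
  refine ⟨N + 1, Fin.cons e₀ e, ?_, ?_, fun i => key _ (hs i) (h1 i),
    fun i => key _ (hs' i) (h2 i)⟩
  · refine linearIndependent_finCons.2 ⟨he, fun h => hfe₀ ?_⟩
    have : span k (range e) ≤ LinearMap.ker f :=
      span_le.2 (by rintro _ ⟨j, rfl⟩; exact (heH j).2)
    exact this h
  · refine Fin.cases (by simpa using he₀) fun j => ?_
    simpa using (heH j).1

end AdaptedBasis

/-! ### Uniqueness of interval decompositions. -/

section Uniqueness

/-- If every member of `A` missed a point of `I`, finitely many such points would have a minimum and
a maximum; a member containing both contains all of them by convexity, including the one it misses.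
-/
lemma exists_superset_of_forall_pair {A : Multiset (Set ℝ)} (hA : ∀ J ∈ A, J.OrdConnected)
    {I : Set ℝ} (hI : I.Nonempty)
    (h : ∀ s ∈ I, ∀ t ∈ I, s ≤ t → ∃ J ∈ A, s ∈ J ∧ t ∈ J) : ∃ J ∈ A, I ⊆ J := by
  classical
  by_contra! hcon
  obtain ⟨x₀, hx₀⟩ := hI
  have hch : ∀ J : Set ℝ, ∃ x ∈ I, J ∈ A → x ∉ J := fun J => by
    by_cases hJ : J ∈ A
    · obtain ⟨x, hx, hxJ⟩ := Set.not_subset.1 (hcon J hJ)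
      exact ⟨x, hx, fun _ => hxJ⟩
    · exact ⟨x₀, hx₀, fun h => absurd h hJ⟩
  choose x hxI hx using hch
  let T : Finset ℝ := insert x₀ (A.toFinset.image x)
  have hT : T.Nonempty := ⟨x₀, Finset.mem_insert_self _ _⟩
  have hTI : ∀ y ∈ T, y ∈ I := by
    intro y hy
    rcases Finset.mem_insert.1 hy with rfl | hy
    · exact hx₀
    · obtain ⟨J, -, rfl⟩ := Finset.mem_image.1 hy
      exact hxI J
  obtain ⟨J, hJ, hs, ht⟩ := h _ (hTI _ (T.min'_mem hT)) _ (hTI _ (T.max'_mem hT))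
    (T.min'_le_max' hT)
  have hxT : x J ∈ T :=
    Finset.mem_insert_of_mem (Finset.mem_image_of_mem x (Multiset.mem_toFinset.2 hJ))
  exact hx J hJ ((hA J hJ).out hs ht ⟨T.min'_le _ hxT, T.le_max' _ hxT⟩)

open Classical in
/-- A finite multiset of nonempty intervals is determined by the numbers of intervals that contain
two given points. -/
theorem multiset_interval_ext {A A' : Multiset (Set ℝ)}
    (hA : ∀ J ∈ A, J.OrdConnected ∧ J.Nonempty) (hA' : ∀ J ∈ A', J.OrdConnected ∧ J.Nonempty)
    (h : ∀ s t, s ≤ t → A.countP (fun J => s ∈ J ∧ t ∈ J) = A'.countP fun J => s ∈ J ∧ t ∈ J) :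
    A = A' := by
  induction hn : A.card using Nat.strong_induction_on generalizing A A' with
  | _ n ih =>
  have hsub : ∀ {C C' : Multiset (Set ℝ)}, (∀ J ∈ C, J.OrdConnected ∧ J.Nonempty) →
      (∀ J ∈ C', J.OrdConnected ∧ J.Nonempty) →
      (∀ s t, s ≤ t → C.countP (fun J => s ∈ J ∧ t ∈ J) = C'.countP fun J => s ∈ J ∧ t ∈ J) →
      ∀ J ∈ C, ∃ J' ∈ C', J ⊆ J' := by
    intro C C' hC hC' hCC' J hJ
    refine exists_superset_of_forall_pair (fun J' h => (hC' J' h).1) (hC J hJ).2 ?_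
    intro s hs t ht hst
    have : 0 < C.countP fun J => s ∈ J ∧ t ∈ J := Multiset.countP_pos.2 ⟨J, hJ, hs, ht⟩
    rw [hCC' s t hst] at this
    exact Multiset.countP_pos.1 this
  have hAA' := hsub hA hA' h
  have hA'A := hsub hA' hA fun s t hst => (h s t hst).symm
  by_cases h0 : A = 0
  · subst h0
    refine (Multiset.eq_zero_of_forall_notMem fun J hJ => ?_).symm
    obtain ⟨J', hJ', -⟩ := hA'A J hJ
    simp at hJ'
  -- An inclusion-maximal interval of `A` lies in one of `A'`, which lies in one of `A`; maximality
  -- makes them equal. It is then removed from both sides.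
  obtain ⟨J, hJ, hmax⟩ := A.toFinset.exists_maximal (by simpa using h0)
  rw [Multiset.mem_toFinset] at hJ
  obtain ⟨J', hJ', hJJ'⟩ := hAA' J hJ
  obtain ⟨J'', hJ'', hJJ''⟩ := hA'A J' hJ'
  have heq : J' = J :=
    (hJJ''.trans (hmax (Multiset.mem_toFinset.2 hJ'') (hJJ'.trans hJJ''))).antisymm hJJ'
  subst heq
  obtain ⟨C, rfl⟩ := Multiset.exists_cons_of_mem hJ
  obtain ⟨C', rfl⟩ := Multiset.exists_cons_of_mem hJ'
  congr 1
  refine ih C.card (by simp at hn; omega) (fun I hI => hA I (Multiset.mem_cons_of_mem hI))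
    (fun I hI => hA' I (Multiset.mem_cons_of_mem hI)) (fun s t hst => ?_) rfl
  have := h s t hst
  simpa [Multiset.countP_cons] using this

variable {k : Type u} [Field k]

open Module

lemma finrank_range_eq_of_iso {W W' : PersistenceModule.{u, v} k} (e : W ≅ W') {s t : ℝ}
    (h : s ⟶ t) : finrank k (LinearMap.range (W.map h).hom) =
      finrank k (LinearMap.range (W'.map h).hom) := by
  have hnat : (W'.map h).hom ∘ₗ (e.app s).toLinearEquiv.toLinearMap =
      (e.app t).toLinearEquiv.toLinearMap ∘ₗ (W.map h).hom := by
    have := congrArg ModuleCat.Hom.hom (e.hom.naturality h)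
    exact this.symm
  have hr : LinearMap.range (W'.map h).hom =
      (LinearMap.range (W.map h).hom).map (e.app t).toLinearEquiv.toLinearMap := by
    rw [← LinearMap.range_comp, ← hnat, LinearMap.range_comp_of_range_eq_top]
    exact LinearEquiv.range _
  rw [hr]
  exact (LinearEquiv.finrank_map_eq _ _).symm

-- The structure map kills every coordinate except those of intervals containing both times; `Φ`
-- reads off these coordinates and is bijective on the range.
open Classical in
lemma finrank_range_directSum {N : ℕ} (J : Fin N → Set ℝ) (hJ : ∀ i, (J i).OrdConnected) {s t : ℝ}
    (h : s ⟶ t) :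
    finrank k (LinearMap.range
      ((directSum fun i => intervalModule.{u, v} k (J i) (hJ i)).map h).hom) =
      (Finset.univ.val.map J).countP fun I => s ∈ I ∧ t ∈ I := by
  let Φ : (DirectSum (Fin N) fun i => intervalSpace.{u, v} k (J i) t) →ₗ[k]
      ({i // s ∈ J i ∧ t ∈ J i} → k) :=
    LinearMap.pi fun i => ULift.moduleEquiv.toLinearMap ∘ₗ Submodule.subtype _ ∘ₗ
      DirectSum.component k (Fin N) (fun i => intervalSpace.{u, v} k (J i) t) i.1
  let g : (DirectSum (Fin N) fun i => intervalSpace.{u, v} k (J i) s) →ₗ[k]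
      (DirectSum (Fin N) fun i => intervalSpace.{u, v} k (J i) t) :=
    DirectSum.lmap fun i => intervalMap.{u, v} k (J i) s t
  change finrank k (LinearMap.range g) = _
  have hval : ∀ x i, ((g x) i).1 = if t ∈ J i then (x i).1 else 0 := fun x i => by
    simp only [g, DirectSum.lmap_apply]
    rfl
  have hinj : Function.Injective (Φ ∘ₗ (LinearMap.range g).subtype) := by
    rintro ⟨_, x, rfl⟩ ⟨_, y, rfl⟩ hxy
    refine Subtype.ext (DFinsupp.ext fun i => Subtype.ext ?_)
    change ((g x) i).1 = ((g y) i).1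
    by_cases hi : s ∈ J i ∧ t ∈ J i
    · exact ULift.ext _ _ (congrFun hxy ⟨i, hi⟩)
    · rw [hval, hval]
      split_ifs with ht
      · rw [(x i).2 fun hs => hi ⟨hs, ht⟩, (y i).2 fun hs => hi ⟨hs, ht⟩]
      · rfl
  have hsurj : Function.Surjective (Φ ∘ₗ (LinearMap.range g).subtype) := by
    intro c
    let x : DirectSum (Fin N) fun i => intervalSpace.{u, v} k (J i) s :=
      DFinsupp.equivFunOnFintype.symm fun i =>
        ⟨ULift.up (if hi : s ∈ J i ∧ t ∈ J i then c ⟨i, hi⟩ else 0), fun hs => by simp [hs]; rfl⟩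
    refine ⟨⟨g x, x, rfl⟩, funext fun i => ?_⟩
    change (((g x) i.1).1).down = c i
    rw [hval, if_pos i.2.2]
    exact dif_pos i.2
  rw [(LinearEquiv.ofBijective _ ⟨hinj, hsurj⟩).finrank_eq, Module.finrank_fintype_fun_eq_card,
    Multiset.countP_map, Fintype.card_subtype]
  rfl

/-- The persistence diagram of a module does not depend on the interval decomposition. -/
theorem IsDiagramOf.unique {W : PersistenceModule.{u, v} k} {D D' : Bar} (h : IsDiagramOf W D)
    (h' : IsDiagramOf W D') : D = D' := by
  classical
  obtain ⟨N, J, hJ, hne, ⟨e⟩, rfl⟩ := h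
  obtain ⟨N', J', hJ', hne', ⟨e'⟩, rfl⟩ := h'
  have : Finset.univ.val.map J = Finset.univ.val.map J' := by
    refine multiset_interval_ext ?_ ?_ fun s t hst => ?_
    · intro I hI
      obtain ⟨i, -, rfl⟩ := Multiset.mem_map.1 hI
      exact ⟨hJ i, (hne i).1⟩
    · intro I hI
      obtain ⟨i, -, rfl⟩ := Multiset.mem_map.1 hI
      exact ⟨hJ' i, (hne' i).1⟩
    · rw [← finrank_range_directSum.{u, v} (k := k) J hJ (homOfLE hst),
        ← finrank_range_directSum.{u, v} (k := k) J' hJ' (homOfLE hst)]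
      exact finrank_range_eq_of_iso (e.symm ≪≫ e') _
  have h2 := congrArg (Multiset.map endpoints) this
  rw [Multiset.map_map, Multiset.map_map] at h2
  exact congrArg Bar.ofMultiset h2

lemma IsDiagramOf.diagram_eq {W : PersistenceModule.{u, v} k} {D : Bar} (h : IsDiagramOf W D) :
    diagram W = D := by
  have hex : ∃ D, IsDiagramOf W D := ⟨D, h⟩
  rw [diagram, dif_pos hex]
  exact hex.choose_spec.unique h

end Uniqueness

/-! ### Subquotients as sums of intervals. -/

section Decomposition

variable {k : Type u} [Field k] {X : Type (max u v)} [AddCommGroup X] [Module k X]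

open Submodule

/-- The linear combination of the vectors `e i` whose coefficients are the components of an element
of a direct sum of interval modules. -/
def intervalSumMap {N : ℕ} (J : Fin N → Set ℝ) (e : Fin N → X) (t : ℝ) :
    (DirectSum (Fin N) fun i => intervalSpace.{u, v} k (J i) t) →ₗ[k] X :=
  ∑ i, (LinearMap.toSpanSingleton k X (e i)) ∘ₗ ULift.moduleEquiv.toLinearMap ∘ₗ
    Submodule.subtype _ ∘ₗ
      DirectSum.component k (Fin N) (fun i => intervalSpace.{u, v} k (J i) t) i

lemma intervalSumMap_apply {N : ℕ} (J : Fin N → Set ℝ) (e : Fin N → X) (t : ℝ)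
    (x : DirectSum (Fin N) fun i => intervalSpace.{u, v} k (J i) t) :
    intervalSumMap J e t x = ∑ i, (x i).1.down • e i := by
  rw [intervalSumMap, LinearMap.sum_apply]
  rfl

lemma intervalSumMap_mem {N : ℕ} {J : Fin N → Set ℝ} {e : Fin N → X} {t : ℝ} {Z : Submodule k X}
    (h : ∀ i, t ∈ J i → e i ∈ Z) (x : DirectSum (Fin N) fun i => intervalSpace.{u, v} k (J i) t) :
    intervalSumMap J e t x ∈ Z := by
  rw [intervalSumMap_apply]
  refine sum_mem fun i _ => ?_
  by_cases ht : t ∈ J i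
  · exact Z.smul_mem _ (h i ht)
  · rw [(x i).2 ht]
    simp

/-- The map from a direct sum of interval modules to a subquotient that is given by vectors `e i`. -/
def intervalSumToSubquotient {N : ℕ} (J : Fin N → Set ℝ) (e : Fin N → X) (t : ℝ)
    (Z B : Submodule k X) (h : ∀ i, t ∈ J i → e i ∈ Z) :
    (DirectSum (Fin N) fun i => intervalSpace.{u, v} k (J i) t) →ₗ[k] Subquotient Z B :=
  (B.submoduleOf Z).mkQ ∘ₗ (intervalSumMap J e t).codRestrict Z (intervalSumMap_mem h)

/-- The basis vectors in `Z` but not in `B` represent a basis of `Z / (B ∩ Z)`: those in `B` vanish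
in the quotient, and independence forbids a nontrivial combination of the others from lying in `B ⊓
Z`. -/
lemma intervalSumToSubquotient_bijective {n N : ℕ} {e : Fin n → X} (he : LinearIndependent k e)
    {g : Fin N → Fin n} (hg : Function.Injective g) {J : Fin N → Set ℝ} {t : ℝ}
    {Z B : Submodule k X} (hZ : Z ≤ span k (e '' {j | e j ∈ Z}))
    (hB : B ⊓ Z ≤ span k (e '' {j | e j ∈ B}))
    (hJ : ∀ i, t ∈ J i ↔ e (g i) ∈ Z ∧ e (g i) ∉ B)
    (hcov : ∀ j, e j ∈ Z → e j ∉ B → j ∈ range g) :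
    Function.Bijective
      (intervalSumToSubquotient.{u, v} J (e ∘ g) t Z B fun i h => ((hJ i).1 h).1) := by
  classical
  constructor
  · refine (injective_iff_map_eq_zero _).2 fun x hx => ?_
    have hxB : intervalSumMap J (e ∘ g) t x ∈ B := by
      have := (Submodule.Quotient.mk_eq_zero _).1 hx
      exact this
    have hxs := hB ⟨hxB, intervalSumMap_mem (fun i h => ((hJ i).1 h).1) x⟩
    obtain ⟨l, hl, hlx⟩ := (Finsupp.mem_span_image_iff_linearCombination k).1 hxs
    have hc : Finsupp.linearCombination k e (∑ i, Finsupp.single (g i) (x i).1.down) =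
        intervalSumMap J (e ∘ g) t x := by
      rw [intervalSumMap_apply, map_sum]
      simp
    -- Two expansions of one vector: the first involves only vectors in `B`, so its coefficients at
    -- the `g i` with `t ∈ J i` are zero.
    have hlc := he (hlx.trans hc.symm)
    refine DFinsupp.ext fun i => Subtype.ext ?_
    by_cases ht : t ∈ J i
    · have h0 : l (g i) = 0 := by
        by_contra h0
        exact ((hJ i).1 ht).2 (hl (Finsupp.mem_support_iff.2 h0))
      rw [hlc, Finsupp.finsetSum_apply, Finset.sum_eq_single i] at h0
      · rw [Finsupp.single_eq_same] at h0
        exact ULift.ext _ _ h0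
      · intro i' _ hi'
        exact Finsupp.single_eq_of_ne fun h => hi' (hg h).symm
      · simp
    · exact (x i).2 ht
  · intro q
    obtain ⟨⟨z, hz⟩, rfl⟩ := Submodule.mkQ_surjective _ q
    have hle : span k (e '' {j | e j ∈ Z}) ≤
        LinearMap.range (intervalSumMap.{u, v} J (e ∘ g) t) ⊔ B := by
      refine span_le.2 ?_
      rintro _ ⟨j, hj, rfl⟩
      by_cases hjB : e j ∈ B
      · exact mem_sup_right hjB
      · obtain ⟨i, rfl⟩ := hcov j hj hjB
        refine mem_sup_left ⟨DFinsupp.equivFunOnFintype.symm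
          (Pi.single i ⟨ULift.up 1, fun h => absurd ((hJ i).2 ⟨hj, hjB⟩) h⟩), ?_⟩
        rw [intervalSumMap_apply, Finset.sum_eq_single i]
        · simp
        · intro i' _ hi'
          simp [dif_neg hi'.symm]
        · simp
    obtain ⟨_, ⟨x, rfl⟩, b, hb, hxb⟩ := mem_sup.1 (hle (hZ hz))
    refine ⟨x, (Submodule.Quotient.eq _).2 ?_⟩
    change intervalSumMap J (e ∘ g) t x - z ∈ B
    rw [← hxb]
    simpa using hb

/-- The structure map only drops coordinates whose interval has ended, and their vectors lie in `B`.
This gives naturality after passing to the quotient. -/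
lemma intervalSumMap_sub_mem {N : ℕ} {J : Fin N → Set ℝ} {e : Fin N → X} {s t : ℝ}
    {B : Submodule k X} (h : ∀ i, s ∈ J i → t ∉ J i → e i ∈ B)
    (x : DirectSum (Fin N) fun i => intervalSpace.{u, v} k (J i) s) :
    intervalSumMap J e s x -
      intervalSumMap J e t (DirectSum.lmap (fun i => intervalMap.{u, v} k (J i) s t) x) ∈ B := by
  classical
  rw [intervalSumMap_apply, intervalSumMap_apply, ← Finset.sum_sub_distrib]
  refine sum_mem fun i _ => ?_
  have hval : ((DirectSum.lmap (fun i => intervalMap.{u, v} k (J i) s t) x) i).1 =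
      if t ∈ J i then (x i).1 else 0 := by
    rw [DirectSum.lmap_apply]
    rfl
  rw [hval]
  split_ifs with ht
  · simp
  · by_cases hs : s ∈ J i
    · simpa using B.smul_mem _ (h i hs ht)
    · rw [(x i).2 hs]
      simp

lemma subquotientMap_intervalSumToSubquotient {N : ℕ} {J : Fin N → Set ℝ} {e : Fin N → X}
    {s t : ℝ} {Z B Z' B' : Submodule k X} (hZ : Z ≤ Z') (hB : B ≤ B')
    (hs : ∀ i, s ∈ J i → e i ∈ Z) (ht : ∀ i, t ∈ J i → e i ∈ Z')
    (h : ∀ i, s ∈ J i → t ∉ J i → e i ∈ B')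
    (x : DirectSum (Fin N) fun i => intervalSpace.{u, v} k (J i) s) :
    subquotientMap hZ hB (intervalSumToSubquotient J e s Z B hs x) =
      intervalSumToSubquotient J e t Z' B' ht
        (DirectSum.lmap (fun i => intervalMap.{u, v} k (J i) s t) x) :=
  (Submodule.Quotient.eq (B'.submoduleOf Z')).2 (intervalSumMap_sub_mem h x)

end Decomposition

/-! ### Persistent homology from an adapted basis. -/

section Homology

variable {k : Type u} [Field k] {V : Type v} [LinearOrder V] {K : PreAbstractSimplicialComplex V}

open Submodule

/-- Linearly independent chains that are adapted to the cycles and the boundaries of all sublevel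
complexes yield an interval decomposition of persistent homology. -/
theorem nonempty_iso_directSum (f : FilterFunction K) (p : ℕ) {n N : ℕ}
    {e : Fin n → Finset V →₀ k} (he : LinearIndependent k e)
    (hZ : ∀ t, cycles k (f.sublevel t) p ≤ span k (e '' {j | e j ∈ cycles k (f.sublevel t) p}))
    (hB : ∀ t, boundaries k (f.sublevel t) p ⊓ cycles k (f.sublevel t) p ≤
      span k (e '' {j | e j ∈ boundaries k (f.sublevel t) p}))
    {g : Fin N → Fin n} (hg : Function.Injective g) {J : Fin N → Set ℝ}
    (hJ : ∀ i t, t ∈ J i ↔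
      e (g i) ∈ cycles k (f.sublevel t) p ∧ e (g i) ∉ boundaries k (f.sublevel t) p)
    (hcov : ∀ j t, e j ∈ cycles k (f.sublevel t) p → e j ∉ boundaries k (f.sublevel t) p →
      j ∈ range g) (hJc : ∀ i, (J i).OrdConnected) :
    Nonempty (persistentHomology k f p ≅
      directSum fun i => intervalModule.{u, v} k (J i) (hJc i)) := by
  have hJZ : ∀ t i, t ∈ J i → (e ∘ g) i ∈ cycles k (f.sublevel t) p :=
    fun t i h => ((hJ i t).1 h).1
  let E : ∀ t, (DirectSum (Fin N) fun i => intervalSpace.{u, v} k (J i) t) ≃ₗ[k]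
      Homology k (f.sublevel t) p := fun t => LinearEquiv.ofBijective
    (intervalSumToSubquotient.{u, v} J (e ∘ g) t (cycles k (f.sublevel t) p)
      (boundaries k (f.sublevel t) p) (hJZ t))
    (intervalSumToSubquotient_bijective.{u, v} he hg (hZ t) (hB t) (fun i => hJ i t)
      (fun j => hcov j t))
  have hE : ∀ {s t : ℝ} (h : s ≤ t) x, homologyMap k (f.sublevel_mono h) p (E s x) =
      E t (DirectSum.lmap (fun i => intervalMap.{u, v} k (J i) s t) x) := by
    intro s t h x
    refine subquotientMap_intervalSumToSubquotient (cycles_mono k (f.sublevel_mono h) p)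
      (boundaries_mono k (f.sublevel_mono h) p) (hJZ s) (hJZ t) (fun i hs ht => ?_) x
    -- A cycle stays a cycle, so an interval can only be left by becoming a boundary.
    by_contra hb
    exact ht ((hJ i t).2 ⟨cycles_mono k (f.sublevel_mono h) p (hJZ s i hs), hb⟩)
  clear_value E
  refine ⟨(NatIso.ofComponents (F := directSum fun i => intervalModule.{u, v} k (J i) (hJc i))
    (G := persistentHomology k f p) (fun t => (E t).toModuleIso) fun {s t} h => ?_).symm⟩
  exact ModuleCat.hom_ext (LinearMap.ext fun x => (hE (leOfHom h) x).symm)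

end Homology

/-! ### Sublevel complexes within an ordering class. -/

section OrderingClass

variable {V : Type v} {K : PreAbstractSimplicialComplex V}

lemma FilterFunction.sublevel_le (f : FilterFunction K) (t : ℝ) : f.sublevel t ≤ K :=
  fun _ h => h.1

/-- A monotone property of complexes that fails for the empty complex begins to hold, along the
sublevel complexes of a filter function, at the value of a simplex (or never); this simplex depends
only on the ordering equivalence class. -/
lemma exists_threshold_simplex [Finite K] (f₀ : FilterFunction K)
    (P : PreAbstractSimplicialComplex V → Prop) (hmono : ∀ L L', L ≤ L' → P L → P L')
    (hbot : ∀ L : PreAbstractSimplicialComplex V, (∀ σ, σ ∉ L) → ¬ P L) :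
    ∃ o : Option K, ∀ f : FilterFunction K, (∀ σ τ, f₀.1 σ ≤ f₀.1 τ ↔ f.1 σ ≤ f.1 τ) →
      ∀ t, P (f.sublevel t) ↔ ∃ σ ∈ o, f.1 σ ≤ t := by
  have hsub : ∀ f : FilterFunction K, (∀ σ τ, f₀.1 σ ≤ f₀.1 τ ↔ f.1 σ ≤ f.1 τ) →
      ∀ t, P (f.sublevel t) → ∃ σ, f.1 σ ≤ t ∧ P (f₀.sublevel (f₀.1 σ)) := by
    intro f hf t ht
    have hne : {σ : K | f.1 σ ≤ t}.Nonempty := by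
      by_contra hcon
      rw [Set.not_nonempty_iff_eq_empty] at hcon
      refine hbot _ (fun σ hσ => ?_) ht
      have : (⟨σ, hσ.1⟩ : K) ∈ {σ : K | f.1 σ ≤ t} := hσ.2
      rw [hcon] at this
      exact this
    -- A highest simplex below level `t` for `f` cuts out, by its value under `f₀`, a sublevel
    -- complex containing `f.sublevel t`.
    obtain ⟨τ, hτ, hmax⟩ := Set.exists_max_image _ f.1 (Set.toFinite _) hne
    refine ⟨τ, hτ, hmono _ _ (fun σ hσ => ?_) ht⟩
    exact ⟨hσ.1, (hf _ _).2 (hmax ⟨σ, hσ.1⟩ hσ.2)⟩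
  by_cases hne : {σ : K | P (f₀.sublevel (f₀.1 σ))}.Nonempty
  · obtain ⟨σ, hσ, hmin⟩ := Set.exists_min_image _ f₀.1 (Set.toFinite _) hne
    refine ⟨some σ, fun f hf t => ⟨fun h => ?_, ?_⟩⟩
    · obtain ⟨τ, hτt, hτ⟩ := hsub f hf t h
      exact ⟨σ, rfl, ((hf _ _).1 (hmin τ hτ)).trans hτt⟩
    · rintro ⟨σ', hσ', ht⟩
      obtain rfl : σ = σ' := Option.some_injective _ hσ'
      exact hmono (f₀.sublevel (f₀.1 σ)) (f.sublevel t) (fun τ hτ => ⟨hτ.1, ((hf _ _).1 hτ.2).trans ht⟩) hσ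
  · refine ⟨none, fun f hf t => ⟨fun h => ?_, ?_⟩⟩
    · obtain ⟨τ, -, hτ⟩ := hsub f hf t h
      exact absurd ⟨τ, hτ⟩ hne
    · rintro ⟨σ, hσ, -⟩
      simp at hσ

/-- `L` is a union of the initial segments of the pre-order on `K` that `f` induces. -/
def FilterFunction.IsInitial (f : FilterFunction K) (L : PreAbstractSimplicialComplex V) : Prop :=
  L ≤ K ∧ ∀ σ τ : K, f.1 τ ≤ f.1 σ → (σ : Finset V) ∈ L → (τ : Finset V) ∈ L

/-- Given a simplex only in `L` and one only in `L'`, the one of lower value would belong to both.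
-/
lemma FilterFunction.IsInitial.le_total {f : FilterFunction K}
    {L L' : PreAbstractSimplicialComplex V} (hL : f.IsInitial L) (hL' : f.IsInitial L') :
    L ≤ L' ∨ L' ≤ L := by
  by_contra! h
  obtain ⟨σ, hσ, hσ'⟩ := SetLike.not_le_iff_exists.1 h.1
  obtain ⟨τ, hτ, hτ'⟩ := SetLike.not_le_iff_exists.1 h.2
  rcases _root_.le_total (f.1 ⟨σ, hL.1 hσ⟩) (f.1 ⟨τ, hL'.1 hτ⟩) with h | h
  · exact hσ' (hL'.2 _ _ h hτ)
  · exact hτ' (hL.2 _ _ h hσ)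

lemma FilterFunction.isInitial_sublevel {f₀ f : FilterFunction K}
    (hf : ∀ σ τ, f₀.1 σ ≤ f₀.1 τ ↔ f.1 σ ≤ f.1 τ) (t : ℝ) : f₀.IsInitial (f.sublevel t) :=
  ⟨f.sublevel_le t, fun _ τ h hσ => ⟨τ.2, ((hf _ _).1 h).trans hσ.2⟩⟩

end OrderingClass

/-! ### Bars given by fixed simplices. -/

section UniformDiagram

variable (k : Type u) [Field k] {V : Type v} {K : PreAbstractSimplicialComplex V}

lemma finiteDimensional_chains [Finite K] (p : ℕ) : FiniteDimensional k (chains k K p) := by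
  have : Finite {σ | σ ∈ K ∧ σ.card = p + 1} :=
    (Set.toFinite (K : Set (Finset V))).subset fun _ h => h.1
  exact Module.Finite.equiv (Finsupp.supportedEquivFinsupp (M := k) (R := k)
    {σ | σ ∈ K ∧ σ.card = p + 1}).symm

lemma chains_eq_bot {L : PreAbstractSimplicialComplex V} (hL : ∀ σ, σ ∉ L) (p : ℕ) :
    chains k L p = ⊥ := by
  have : {σ | σ ∈ L ∧ σ.card = p + 1} = ∅ := Set.eq_empty_of_forall_notMem fun σ h => hL σ h.1
  rw [chains, this, Finsupp.supported_empty]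

lemma endpoints_Ico {a b : ℝ} (h : a < b) : endpoints (Ico a b) = (a, (b : WithTop ℝ)) := by
  rw [endpoints, if_pos bddAbove_Ico, csInf_Ico h, csSup_Ico h]

lemma endpoints_Ici (a : ℝ) : endpoints (Ici a) = (a, ⊤) := by
  rw [endpoints, if_neg (not_bddAbove_Ici a), csInf_Ici]

variable [LinearOrder V]

/-- On an ordering equivalence class, the bars of the persistence diagram of a filter function start
and end at its values at fixed simplices. -/
theorem exists_simplices_dgm_eq [Finite K] (f₀ : FilterFunction K) (p : ℕ) :
    ∃ (m n : ℕ) (b d : Fin m → K) (v : Fin n → K), ∀ f : FilterFunction K,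
      (∀ σ τ, f₀.1 σ ≤ f₀.1 τ ↔ f.1 σ ≤ f.1 τ) →
      Dgm k p f = Q m n (fun i => (f.1 (b i), f.1 (d i)), fun j => f.1 (v j)) := by
  classical
  have := finiteDimensional_chains k (K := K) p
  -- Indexing by all initial subcomplexes makes one basis serve every `f` in the ordering class.
  obtain ⟨n, e, he, heK, heZ, heB⟩ := exists_adapted_basis
    (fun L : {L // f₀.IsInitial L} => cycles k L.1 p)
    (fun L : {L // f₀.IsInitial L} => boundaries k L.1 p)
    (fun L L' => (L.2.le_total L'.2).imp (cycles_mono k · p) (cycles_mono k · p))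
    (fun L L' => (L.2.le_total L'.2).imp (boundaries_mono k · p) (boundaries_mono k · p))
    (chains k K p)
  choose β hβ using fun j => exists_threshold_simplex f₀ (fun L => e j ∈ cycles k L p)
    (fun L L' h => (cycles_mono k h p ·)) fun L hL h => he.ne_zero j (by
      have := h.1
      rwa [chains_eq_bot k hL] at this)
  choose δ hδ using fun j => exists_threshold_simplex f₀ (fun L => e j ∈ boundaries k L p)
    (fun L L' h => (boundaries_mono k h p ·)) fun L hL h => he.ne_zero j (by
      rwa [boundaries, chains_eq_bot k hL, Submodule.map_bot] at h)
  -- `I` indexes the finite bars and `I'` the infinite ones. A vector that never becomes a cycle, or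
  -- is a boundary no later than it is a cycle, gives no bar.
  let I : Type := {j // ∃ σ τ, β j = some σ ∧ δ j = some τ ∧ f₀.1 σ < f₀.1 τ}
  let I' : Type := {j // ∃ σ, β j = some σ ∧ δ j = none}
  let a : Fin (Fintype.card I) → I := (Fintype.equivFin I).symm
  let a' : Fin (Fintype.card I') → I' := (Fintype.equivFin I').symm
  choose b d hb hd hbd using fun i => (a i).2
  choose v hv hv' using fun i => (a' i).2
  refine ⟨_, _, b, d, v, fun f hf => IsDiagramOf.diagram_eq ?_⟩
  have hlt : ∀ i, f.1 (b i) < f.1 (d i) := fun i => by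
    have := hbd i
    rwa [← not_le, hf, not_le] at this
  let J : Fin (Fintype.card I + Fintype.card I') → Set ℝ :=
    Fin.append (fun i => Ico (f.1 (b i)) (f.1 (d i))) fun j => Ici (f.1 (v j))
  let g : Fin (Fintype.card I + Fintype.card I') → Fin n :=
    Fin.append (fun i => (a i).1) fun j => (a' j).1
  have hg : Function.Injective g := by
    have hdis : ∀ i j, (a i).1 ≠ (a' j).1 := fun i j h => by
      have h1 := hd i
      rw [h, hv' j] at h1
      simp at h1
    intro i i' h
    induction i using Fin.addCases <;> induction i' using Fin.addCases <;>
      simp only [g, Fin.append_left, Fin.append_right] at h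
    · rw [(Fintype.equivFin I).symm.injective (Subtype.ext h)]
    · exact absurd h (hdis _ _)
    · exact absurd h.symm (hdis _ _)
    · rw [(Fintype.equivFin I').symm.injective (Subtype.ext h)]
  have hJ : ∀ i t, t ∈ J i ↔
      e (g i) ∈ cycles k (f.sublevel t) p ∧ e (g i) ∉ boundaries k (f.sublevel t) p := by
    intro i t
    rw [hβ _ f hf, hδ _ f hf]
    induction i using Fin.addCases <;> simp only [g, J, Fin.append_left, Fin.append_right]
    · simp [hb, hd]
    · simp [hv, hv']
  have hcov : ∀ j t, e j ∈ cycles k (f.sublevel t) p → e j ∉ boundaries k (f.sublevel t) p →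
      j ∈ range g := by
    intro j t hj hj'
    rw [hβ _ f hf] at hj
    rw [hδ _ f hf] at hj'
    obtain ⟨σ, hσ, hσt⟩ := hj
    rcases hτ : δ j with _ | τ
    · refine ⟨Fin.natAdd _ (Fintype.equivFin I' ⟨j, σ, hσ, hτ⟩), ?_⟩
      simp [g, a']
    · have hσt' : f₀.1 σ < f₀.1 τ := by
        rw [← not_le, hf, not_le]
        exact hσt.trans_lt (not_le.1 fun h => hj' ⟨τ, hτ, h⟩)
      refine ⟨Fin.castAdd _ (Fintype.equivFin I ⟨j, σ, τ, hσ, hτ, hσt'⟩), ?_⟩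
      simp [g, a]
  have hJc : ∀ i, (J i).OrdConnected := by
    intro i
    induction i using Fin.addCases <;> simp only [J, Fin.append_left, Fin.append_right]
    · exact ordConnected_Ico
    · exact ordConnected_Ici
  refine ⟨_, J, hJc, fun i => ?_, nonempty_iso_directSum f p he (fun t => ?_) (fun t => ?_) hg hJ
    hcov hJc, ?_⟩
  · induction i using Fin.addCases <;> simp only [J, Fin.append_left, Fin.append_right]
    · exact ⟨nonempty_Ico.2 (hlt _), bddBelow_Ico⟩
    · exact ⟨nonempty_Ici, bddBelow_Ici⟩
  · exact (le_inf le_rfl (inf_le_left.trans (chains_mono k (f.sublevel_le t) p))).trans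
      (heZ ⟨_, FilterFunction.isInitial_sublevel hf t⟩)
  · exact (inf_le_inf_left _ (inf_le_left.trans (chains_mono k (f.sublevel_le t) p))).trans
      (heB ⟨_, FilterFunction.isInitial_sublevel hf t⟩)
  · have hend : (fun i => endpoints (J i)) = Fin.append
        (fun i => (f.1 (b i), ((f.1 (d i) : ℝ) : WithTop ℝ))) fun j => (f.1 (v j), ⊤) := by
      funext i
      induction i using Fin.addCases <;> simp only [J, Fin.append_left, Fin.append_right]
      · exact endpoints_Ico (hlt _)
      · exact endpoints_Ici _
    rw [Q, hend, Fin.univ_val_map, Fin.univ_val_map, Fin.univ_val_map, List.ofFn_fin_append,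
      Multiset.coe_add]

end UniformDiagram

/-! ### Strata: openness and constancy of the pre-order. -/

section Manifold

variable {d : ℕ} {M : Type*} [TopologicalSpace M] [ChartedSpace (EuclideanSpace ℝ (Fin d)) M]

/-- A slice of full dimension is the whole chart domain. -/
lemma IsSubmanifold.isOpen {S : Set M} (hS : IsSubmanifold (d := d) d S) : IsOpen S := by
  refine isOpen_iff_mem_nhds.2 fun x hx => ?_
  obtain ⟨φ, W, hxφ, hφ, hW⟩ := hS x hx
  have hW' : W = ⊤ := Submodule.eq_top_of_finrank_eq (by simpa using hW)
  refine Filter.mem_of_superset (φ.open_source.mem_nhds hxφ) fun y hy => ?_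
  exact (hφ.2 y hy).2 (hW' ▸ Submodule.mem_top)

/-- A function that is weakly stratified with respect to the ordering classes induces the same
pre-order at all points of a stratum. -/
lemma IsWeaklyStratified.orderingEquivalent {α κ : Type*} {F : α → κ → ℝ} {𝒮 : Set (Set α)}
    (h : IsWeaklyStratified F 𝒮 (orderingClasses κ)) (h𝒮 : 𝒮.PairwiseDisjoint id) {S : Set α}
    (hS : S ∈ 𝒮) {x y : α} (hx : x ∈ S) (hy : y ∈ S) (σ τ : κ) :
    F x σ ≤ F x τ ↔ F y σ ≤ F y τ := by
  obtain ⟨𝒰, h𝒰, hF⟩ := h {g | orderingSetoid κ g (F x)} ⟨F x, rfl⟩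
  have hxF : x ∈ ⋃₀ 𝒰 := hF ▸ (orderingSetoid κ).refl (F x)
  obtain ⟨S', hS', hxS'⟩ := hxF
  obtain rfl : S = S' := h𝒮.elim_set hS (h𝒰 hS') x hx hxS'
  have hyF : y ∈ F ⁻¹' {g | orderingSetoid κ g (F x)} := hF ▸ ⟨S, hS', hy⟩
  exact ((orderingSetoid κ).symm hyF) σ τ

end Manifold

end DiscreteSmoothness

theorem mainTheorem5
    -- a field of coefficients, a finite abstract simplicial complex, a homology degree
    (k : Type*) [Field k] {V : Type*} [LinearOrder V]
    (K : PreAbstractSimplicialComplex V) [Fintype K] (p : ℕ)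
    -- a smooth manifold of dimension `d`
    (d : ℕ) {M : Type*} [TopologicalSpace M] [ChartedSpace (EuclideanSpace ℝ (Fin d)) M]
    [IsManifold (𝓡 d) ∞ M]
    -- a parametrization with values in the filter functions, and a Whitney stratification
    (r : ℕ) (F : M → K → ℝ) (hF : ∀ x, Monotone (F x))
    (𝒮 : Set (Set M)) (h𝒮 : IsWhitneyStratification d 𝒮)
    (h1 : IsWeaklyStratified F 𝒮 (orderingClasses K))
    (h2 : ∀ S ∈ 𝒮, ContDiffOnSubmanifold d r F S)
    (h3 : ∀ x : M, ∀ S ∈ 𝒮, x ∈ closure S → ∃ U : Set M, IsOpen U ∧ x ∈ U ∧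
      ∃ G : M → K → ℝ, ContMDiffOn (𝓡 d) 𝓘(ℝ, K → ℝ) r G U ∧ ∀ y ∈ S ∩ U, G y = F y)
    -- the barcode valued map
    (B : M → Bar) (hB : ∀ x, B x = Dgm k p (⟨F x, hF x⟩ : FilterFunction K)) :
    (∀ x : M, ∀ S ∈ 𝒮, x ∈ closure S →
      RDifferentiableAlong d r B S x ∧
      (1 ≤ r → ∃ (m n : ℕ) (D : TangentSpace (𝓡 d) x →L[ℝ] OrderedBarcode m n),
        IsDirectionalDerivative d r B S x D)) ∧
    (∀ S ∈ 𝒮, IsSubmanifold (d := d) d S → ∀ x ∈ S, RDifferentiableAt d r B x) := by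

  have hfirst : ∀ x : M, ∀ S ∈ 𝒮, x ∈ closure S → RDifferentiableAlong d r B S x := by
    intro x S hS hx
    obtain ⟨U, hU, hxU, G, hG, hGF⟩ := h3 x S hS hx
    -- The pre-order is taken at a point of `S`, because `x` may lie only in the closure, where `F
    -- x` can induce another one.
    obtain ⟨y₀, hy₀⟩ := (h𝒮.connected S hS).nonempty
    obtain ⟨m, n, b, e, v, hD⟩ := exists_simplices_dgm_eq k (⟨F y₀, hF y₀⟩ : FilterFunction K) p
    refine ⟨U, m, n, fun y => (fun i => (G y (b i), G y (e i)), fun j => G y (v j)),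
      hU, hxU, ?_, fun y hy => ?_⟩
    · have hL : ContDiff ℝ r (fun g : K → ℝ =>
          ((fun i => (g (b i), g (e i)), fun j => g (v j)) : OrderedBarcode m n)) := by
        fun_prop
      exact hL.contMDiff.comp_contMDiffOn hG
    -- Off `S` the values of `G` need not be filter functions, so the diagram is compared only on
    -- `S`.
    · rw [hGF y ⟨hy.2, hy.1⟩]
      exact (hB y).trans (hD ⟨F y, hF y⟩
        fun σ τ => h1.orderingEquivalent h𝒮.partition.1 hS hy₀ hy.2 σ τ)
  refine ⟨fun x S hS hx => ⟨hfirst x S hS hx, fun hr => ?_⟩, fun S hS hSd x hx => ?_⟩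
  · obtain ⟨U, m, n, B', hB'⟩ := hfirst x S hS hx
    refine ⟨m, n, mfderiv (𝓡 d) 𝓘(ℝ, OrderedBarcode m n) B' x, U, B', hB', ?_⟩
    exact ((hB'.contMDiffOn.contMDiffAt (hB'.isOpen.mem_nhds hB'.mem)).mdifferentiableAt
      (by exact_mod_cast (Nat.one_le_iff_ne_zero.1 hr))).hasMFDerivAt
  · obtain ⟨U, m, n, B', hB'⟩ := hfirst x S hS (subset_closure hx)
    exact ⟨U ∩ S, hB'.isOpen.inter hSd.isOpen, ⟨hB'.mem, hx⟩, m, n, B',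
      hB'.contMDiffOn.mono inter_subset_left, hB'.lifts⟩
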